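/- Let $(\Omega,\mathcal F,\mathbb P)$ be a probability space. A real random variable $X$ is called \emph{super-Pareto} if it has the same distribution as $f(Z)$ for some increasing (not necessarily strictly), convex and non-constant function $f:[1,\infty)\to\mathbb R$ and some random variable $Z$ with the Pareto(1) distribution, $\mathbb P(Z\le z)=1-1/z$ for $z\ge 1$. Write $z_X=\inf\{z\in\mathbb R:\mathbb P(X\le z)>0\}$ for the essential infimum of $X$, and write $Y\ge_{\rm st}X$ if $\mathbb P(Y>t)\ge\mathbb P(X>t)$ for all $t\in\mathbb R$. \textbf{Proposition.} Let $X$ be a super-Pareto random variable, let $x\in\mathbb R$ with $x\ge z_X$, and let $Y_1,\dots,Y_n$ be iid random variables with the same distribution as a random variable $Y$. Assume that $\mathbb P(Y>t)=\mathbb P(X>t)$ for all $t\ge x$, and that $Y\ge_{\rm st}X$. Let $\theta_1,\dots,\theta_n\ge 0$ with $\sum_{i=1}^n\theta_i=1$. Then, for every $t\ge x$, $$\mathbb P\Big(\sum_{i=1}^n\theta_iY_i>t\Big)\ \ge\ \mathbb P(Y>t),$$ and this inequality is strict if $t>z_X$ and $\theta_i>0$ for at least two indices $i$. -/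

import Mathlib

open MeasureTheory ProbabilityTheory Set

/-- The function `f` is increasing, convex and non-constant on `[1, ∞)`, the support of the
Pareto(1) distribution. -/
def IsSuperParetoTransform (f : ℝ → ℝ) : Prop :=
  MonotoneOn f (Ici 1) ∧ ConvexOn ℝ (Ici 1) f ∧ ∃ a ∈ Ici (1 : ℝ), ∃ b ∈ Ici (1 : ℝ), f a ≠ f b

/-- Such an `f` is a.e. measurable for the Pareto(1) law, so that its law under Pareto(1) is a
genuine push-forward. -/
theorem IsSuperParetoTransform.aemeasurable {f : ℝ → ℝ} (hf : IsSuperParetoTransform f) :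
    AEMeasurable f (paretoMeasure 1 1) := by
  have h1 : AEMeasurable f (volume.restrict (Ici (1 : ℝ))) :=
    aemeasurable_restrict_of_monotoneOn measurableSet_Ici hf.1
  refine h1.mono_ac (Measure.AbsolutelyContinuous.mk fun s hs h0 => ?_)
  rw [Measure.restrict_apply hs] at h0
  rw [paretoMeasure, withDensity_apply _ hs, ← lintegral_inter_add_sdiff _ s (measurableSet_Ici (a := (1 : ℝ))),
    setLIntegral_measure_zero _ _ h0, zero_add,
    setLIntegral_congr_fun (g := fun _ => 0) (hs.diff measurableSet_Ici)
      (fun y hy => paretoPDF_of_lt (not_le.mp hy.2)), lintegral_zero]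

/-- The random variable `X` is super-Pareto: it has the same distribution as `f(Z)` for some
increasing, convex and non-constant function `f` and `Z ∼ Pareto(1)`.  Here Pareto(1) is the
distribution with scale `1` and tail parameter `1`, i.e. with distribution function `1 - 1/x`
for `x ≥ 1`. -/
def IsSuperPareto {Ω : Type*} [MeasurableSpace Ω] (X : Ω → ℝ) (P : Measure Ω) : Prop :=
  ∃ f : ℝ → ℝ, IsSuperParetoTransform f ∧ HasLaw X ((paretoMeasure 1 1).map f) P

/-- First-order stochastic dominance `X ≤_st Y`. -/
def StochasticLE {Ω : Type*} [MeasurableSpace Ω] (X Y : Ω → ℝ) (P : Measure Ω) : Prop :=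
  ∀ t : ℝ, P {ω | t < X ω} ≤ P {ω | t < Y ω}

/-- `Y` is distributed as `X` beyond `x`. -/
def DistributedAsBeyond {Ω : Type*} [MeasurableSpace Ω] (Y X : Ω → ℝ) (x : ℝ)
    (P : Measure Ω) : Prop :=
  ∀ t : ℝ, x ≤ t → P {ω | t < Y ω} = P {ω | t < X ω}

/-! One large summand suffices. Write `X` as `g(Z)` in law, `g` convex and increasing on the line,
and `t = g c` with `c` maximal, so that `P(Y > t) = 1 / c`. Put `d i = 1 + (c - 1) / θ i`; then `c =
θ i * d i + (1 - θ i) * 1`. All `Y j ≥ g 1` almost surely, so by convexity `Y i > g (d i)` alone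
forces the average above `g c` (`ConvexOn.lt_sum_of_lt`). Independence and `P(Y > g (d i)) ≥ 1 / d
i` bound the probability of the complement by `∏ (1 - 1 / d i)`. For `c > 1` this is `∏ (1 + θ i /
(c - 1))⁻¹ ≤ (1 + 1 / (c - 1))⁻¹ = 1 - 1 / c`, and two positive weights leave a cross term that
makes it strict. -/

theorem paretoMeasure_one_one_real_Ioi {d : ℝ} (hd : 1 ≤ d) :
    (paretoMeasure 1 1).real (Ioi d) = 1 / d := by
  have hd0 : 0 < d := by linarith
  have h : ∫⁻ z in Ioi d, paretoPDF 1 1 z = ∫⁻ z in Ioi d, ENNReal.ofReal (z ^ (-2 : ℝ)) := by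
    refine setLIntegral_congr_fun measurableSet_Ioi fun z hz => ?_
    simp only [paretoPDF_of_le (hd.trans (le_of_lt hz))]
    norm_num
  rw [measureReal_def, paretoMeasure, withDensity_apply _ measurableSet_Ioi, h,
    ← integral_eq_lintegral_of_nonneg_ae, integral_Ioi_rpow_of_lt (by norm_num) hd0]
  · norm_num [Real.rpow_neg_one]
  · refine (ae_restrict_iff' measurableSet_Ioi).mpr <| ae_of_all _ fun z (hz : d < z) => ?_
    exact Real.rpow_nonneg (hd0.trans hz).le _
  · exact (measurable_id.pow_const _).aestronglyMeasurable

theorem ConvexOn.tendsto_atTop_of_lt {g : ℝ → ℝ} (hg : ConvexOn ℝ univ g) {a b : ℝ}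
    (hab : a < b) (h : g a < g b) : Filter.Tendsto g Filter.atTop Filter.atTop := by
  have hs : 0 < (g b - g a) / (b - a) := div_pos (sub_pos.2 h) (sub_pos.2 hab)
  refine Filter.tendsto_atTop_mono' (f₁ := fun z => g b + (g b - g a) / (b - a) * (z - b)) _ ?_ ?_
  · filter_upwards [Filter.eventually_gt_atTop b] with z hz
    have := hg.slope_mono_adjacent (mem_univ a) (mem_univ z) hab hz
    rw [le_div_iff₀ (sub_pos.2 hz)] at this
    linarith
  · exact Filter.tendsto_atTop_add_const_left _ _
      ((Filter.tendsto_atTop_add_const_right _ _ Filter.tendsto_id).const_mul_atTop hs)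

theorem IsSuperParetoTransform.exists_extension {f : ℝ → ℝ} (hf : IsSuperParetoTransform f) :
    ∃ g : ℝ → ℝ, Monotone g ∧ ConvexOn ℝ univ g ∧ (∀ z, 1 ≤ z → g z = f z) ∧
      Filter.Tendsto g Filter.atTop Filter.atTop := by
  obtain ⟨hmono, hconv, a, ha, b, hb, hne⟩ := hf
  -- Extending `f` by the constant `f 1` to the left of `1` keeps it monotone and convex.
  have hmax : ConvexOn ℝ univ fun z : ℝ => max 1 z :=
    (convexOn_const 1 convex_univ).sup (convexOn_id convex_univ)
  have himg : (fun z : ℝ => max 1 z) '' univ = Ici 1 := by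
    ext z
    simp only [image_univ, mem_range, mem_Ici]
    exact ⟨fun ⟨y, hy⟩ => hy ▸ le_max_left _ _, fun hz => ⟨z, max_eq_right hz⟩⟩
  have hg : ConvexOn ℝ univ (f ∘ fun z : ℝ => max 1 z) :=
    ConvexOn.comp (himg ▸ hconv) hmax (himg ▸ hmono)
  refine ⟨f ∘ fun z : ℝ => max 1 z,
    fun y z hyz => hmono (mem_Ici.2 (le_max_left 1 y)) (mem_Ici.2 (le_max_left 1 z))
      (max_le_max le_rfl hyz), hg,
    fun z hz => by simp [max_eq_right hz], ?_⟩
  have key : ∀ {a b : ℝ}, 1 ≤ a → 1 ≤ b → a < b → f a ≠ f b →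
      Filter.Tendsto (f ∘ fun z : ℝ => max 1 z) Filter.atTop Filter.atTop := by
    intro a b ha hb hab hne
    refine hg.tendsto_atTop_of_lt hab ?_
    simp only [Function.comp, max_eq_right ha, max_eq_right hb]
    exact lt_of_le_of_ne (hmono ha hb hab.le) hne
  rcases lt_trichotomy a b with hab | rfl | hab
  · exact key ha hb hab hne
  · exact absurd rfl hne
  · exact key hb ha hab hne.symm

/-- The last point `c` at which an unbounded increasing convex function takes the value `t`; the
function is strictly increasing from there on. -/
theorem ConvexOn.exists_eq_and_strictMonoOn_Ici {g : ℝ → ℝ} (hmono : Monotone g)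
    (hconv : ConvexOn ℝ univ g) (htop : Filter.Tendsto g Filter.atTop Filter.atTop) {a t : ℝ}
    (ht : g a ≤ t) : ∃ c, a ≤ c ∧ g c = t ∧ StrictMonoOn g (Ici c) := by
  have hcont : Continuous g := continuousOn_univ.1 (hconv.continuousOn isOpen_univ)
  obtain ⟨M, hM⟩ := (htop.eventually_gt_atTop t).exists
  have haM : a ≤ M := le_of_lt (hmono.reflect_lt (ht.trans_lt hM))
  have hbdd : BddAbove (g ⁻¹' Iic t) := ⟨M, fun z hz => (hmono.reflect_lt (lt_of_le_of_lt hz hM)).le⟩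
  have hmem := (isClosed_Iic.preimage hcont).csSup_mem ⟨a, ht⟩ hbdd
  set c := sSup (g ⁻¹' Iic t)
  obtain ⟨y, -, hy⟩ := intermediate_value_Icc haM hcont.continuousOn ⟨ht, hM.le⟩
  have hc : g c = t := le_antisymm hmem (hy ▸ hmono (le_csSup hbdd hy.le))
  have hgt : ∀ z, c < z → g c < g z := fun z hz => by
    by_contra h
    exact absurd (le_csSup hbdd (show z ∈ g ⁻¹' Iic t from hc ▸ not_lt.1 h)) (not_le.2 hz)
  refine ⟨c, le_csSup hbdd ht, hc, fun d hd z _ hdz => ?_⟩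
  rcases eq_or_lt_of_le (mem_Ici.1 hd) with rfl | hd
  · exact hgt z hdz
  -- The slope on `[d, z]` is at least that on `[c, d]`, which is positive.
  · have := hconv.slope_mono_adjacent (mem_univ c) (mem_univ z) hd hdz
    have h2 := (div_pos (sub_pos.2 (hgt d hd)) (sub_pos.2 hd)).trans_le this
    rwa [div_pos_iff_of_pos_right (sub_pos.2 hdz), sub_pos] at h2

theorem Finset.one_add_sum_le_prod_one_add_of_nonneg {ι : Type*} (s : Finset ι) {a : ι → ℝ}
    (ha : ∀ i, 0 ≤ a i) : 1 + ∑ i ∈ s, a i ≤ ∏ i ∈ s, (1 + a i) := by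
  classical
  induction s using Finset.induction_on with
  | empty => simp
  | insert i s hi ih =>
    rw [Finset.sum_insert hi, Finset.prod_insert hi]
    nlinarith [ha i, mul_nonneg (ha i) (Finset.sum_nonneg fun j (_ : j ∈ s) => ha j),
      mul_le_mul_of_nonneg_left ih (ha i)]

theorem Finset.one_add_sum_lt_prod_one_add_of_nonneg {ι : Type*} (s : Finset ι) {a : ι → ℝ}
    (ha : ∀ i, 0 ≤ a i) {i j : ι} (hij : i ≠ j) (hi : i ∈ s) (hj : j ∈ s) (hai : 0 < a i)
    (haj : 0 < a j) : 1 + ∑ k ∈ s, a k < ∏ k ∈ s, (1 + a k) := by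
  classical
  rw [← Finset.add_sum_erase s a hi, ← Finset.mul_prod_erase s _ hi]
  have hj' : j ∈ s.erase i := Finset.mem_erase.2 ⟨hij.symm, hj⟩
  have h := (s.erase i).one_add_sum_le_prod_one_add_of_nonneg ha
  have hpos : 0 < ∑ k ∈ s.erase i, a k :=
    haj.trans_le (Finset.single_le_sum (fun k _ => ha k) hj')
  nlinarith [mul_pos hai hpos, mul_le_mul_of_nonneg_left h hai.le]

/-- Needed because `essInf` in `ℝ` is a conditional supremum. Almost sure `X > M` for every natural
`M` is impossible under a nonzero measure. -/
theorem isCoboundedUnder_ge_ae_real {Ω : Type*} [MeasurableSpace Ω] {P : Measure Ω}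
    [NeZero P] (X : Ω → ℝ) :
    Filter.IsCoboundedUnder (· ≥ ·) (ae P) X := by
  obtain ⟨M, hM⟩ : ∃ M : ℕ, ∃ᶠ ω in ae P, X ω ≤ M := by
    by_contra h
    simp only [not_exists, Filter.not_frequently] at h
    obtain ⟨ω, hω⟩ := (ae_all_iff.2 h).exists
    obtain ⟨M, hM⟩ := exists_nat_ge (X ω)
    exact hω M hM
  exact Filter.IsCoboundedUnder.of_frequently_le hM

theorem measureReal_lt_of_hasLaw_map_pareto {Ω : Type*} [MeasurableSpace Ω] {P : Measure Ω}
    [IsProbabilityMeasure P] {f : ℝ → ℝ} {X : Ω → ℝ}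
    (hf : IsSuperParetoTransform f) (hX : HasLaw X ((paretoMeasure 1 1).map f) P) (u : ℝ) :
    P.real {ω | u < X ω} = (paretoMeasure 1 1).real {z | 1 ≤ z ∧ u < f z} := by
  rw [measureReal_def, measureReal_def, hX.measure_eq (p := fun y => u < y) measurableSet_Ioi,
    show {y : ℝ | u < y} = Ioi u from rfl, Measure.map_apply_of_aemeasurable hf.aemeasurable measurableSet_Ioi]
  congr 1
  refine measure_congr ?_
  have h1 : ∀ᵐ z ∂paretoMeasure 1 1, 1 ≤ z := by
    rw [ae_iff]
    simp only [not_le]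
    change paretoMeasure 1 1 (Iio 1) = 0
    rw [paretoMeasure, withDensity_apply _ measurableSet_Iio, lintegral_paretoPDF_of_le le_rfl]
  filter_upwards [h1] with z hz
  exact propext ⟨fun h => ⟨hz, h⟩, fun h => h.2⟩

/-- The tail of `X = g(Z)` with `Z ∼ Pareto(1)`, at a level `g d` beyond which `g` is strictly
increasing. -/
theorem measureReal_lt_apply_of_hasLaw_map_pareto {Ω : Type*} [MeasurableSpace Ω] {P : Measure Ω}
    [IsProbabilityMeasure P] {f g : ℝ → ℝ}
    {X : Ω → ℝ} (hf : IsSuperParetoTransform f) (hX : HasLaw X ((paretoMeasure 1 1).map f) P)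
    (hmono : Monotone g) (hfg : ∀ z, 1 ≤ z → g z = f z) {d : ℝ} (hd : 1 ≤ d)
    (hgd : StrictMonoOn g (Ici d)) : P.real {ω | g d < X ω} = 1 / d := by
  rw [measureReal_lt_of_hasLaw_map_pareto hf hX, ← paretoMeasure_one_one_real_Ioi hd]
  congr 1
  ext z
  simp only [mem_ofPred_eq, mem_Ioi]
  constructor
  · rintro ⟨hz, h⟩
    exact hmono.reflect_lt (hfg z hz ▸ h)
  · intro hz
    have h1 : 1 ≤ z := hd.trans hz.le
    exact ⟨h1, hfg z h1 ▸ hgd self_mem_Ici hz.le hz⟩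

theorem measure_lt_eq_one_of_hasLaw_map_pareto {Ω : Type*} [MeasurableSpace Ω] {P : Measure Ω}
    [IsProbabilityMeasure P] {f : ℝ → ℝ} {X : Ω → ℝ}
    (hf : IsSuperParetoTransform f) (hX : HasLaw X ((paretoMeasure 1 1).map f) P) :
    ∀ u < f 1, P {ω | u < X ω} = 1 := by
  intro u hu
  have := isProbabilityMeasure_paretoMeasure one_pos one_pos
  rw [← ENNReal.toReal_eq_one_iff, ← measureReal_def, measureReal_lt_of_hasLaw_map_pareto hf hX]
  refine le_antisymm measureReal_le_one ?_
  calc (1 : ℝ) = (paretoMeasure 1 1).real (Ioi 1) := by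
        rw [paretoMeasure_one_one_real_Ioi le_rfl, div_one]
    _ ≤ _ := measureReal_mono (s₂ := {z | 1 ≤ z ∧ u < f z}) fun z (hz : 1 < z) =>
        ⟨hz.le, hu.trans_le (hf.1 self_mem_Ici hz.le hz.le)⟩

theorem ae_le_of_measure_lt_eq_one {Ω : Type*} [MeasurableSpace Ω] {P : Measure Ω}
    [IsProbabilityMeasure P] {Y : Ω → ℝ} {m : ℝ}
    (hY : AEMeasurable Y P) (h : ∀ u < m, P {ω | u < Y ω} = 1) : ∀ᵐ ω ∂P, m ≤ Y ω := by
  have h' : ∀ k : ℕ, ∀ᵐ ω ∂P, m - 1 / (k + 1) < Y ω := fun k => by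
    have hs : NullMeasurableSet {ω | m - 1 / ((k : ℝ) + 1) < Y ω} P :=
      hY.nullMeasurableSet_preimage measurableSet_Ioi
    exact (prob_compl_eq_zero_iff₀ hs).2 (h _ (sub_lt_self _ (by positivity)))
  filter_upwards [ae_all_iff.2 h'] with ω hω
  refine le_of_forall_pos_lt_add fun ε hε => ?_
  obtain ⟨k, hk⟩ := exists_nat_one_div_lt hε
  linarith [hω k]

/-- With `Y i ≥ g 1`, one summand beyond `g (1 + (c - 1) / θ i)` suffices for the weighted average
to exceed `g c`. -/
theorem ConvexOn.lt_sum_of_lt {n : ℕ} {g : ℝ → ℝ} (hconv : ConvexOn ℝ univ g) {θ y : Fin n → ℝ}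
    (hθ : θ ∈ stdSimplex ℝ (Fin n)) (hy : ∀ i, g 1 ≤ y i) {i : Fin n} (hi : 0 < θ i) {c : ℝ}
    (h : g (1 + (c - 1) / θ i) < y i) : g c < ∑ j, θ j * y j := by
  have hθi : θ i ≤ 1 := hθ.2 ▸ Finset.single_le_sum (fun j _ => hθ.1 j) (Finset.mem_univ i)
  have h1 := hconv.2 (mem_univ (1 + (c - 1) / θ i)) (mem_univ 1) hi.le (sub_nonneg.2 hθi)
    (add_sub_cancel _ _)
  have h2 : θ i • (1 + (c - 1) / θ i) + (1 - θ i) • (1 : ℝ) = c := by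
    simp only [smul_eq_mul]
    field_simp
    ring
  rw [h2, smul_eq_mul, smul_eq_mul] at h1
  have h3 : ∑ j ∈ Finset.univ.erase i, θ j = 1 - θ i := by
    rw [← hθ.2, ← Finset.add_sum_erase _ θ (Finset.mem_univ i)]
    ring
  calc g c ≤ θ i * g (1 + (c - 1) / θ i) + (1 - θ i) * g 1 := h1
    _ < θ i * y i + (1 - θ i) * g 1 := by gcongr
    _ ≤ θ i * y i + ∑ j ∈ Finset.univ.erase i, θ j * y j := by
        rw [← h3, Finset.sum_mul]
        gcongr with j
        · exact hθ.1 j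
        · exact hy j
    _ = ∑ j, θ j * y j := Finset.add_sum_erase _ (fun j => θ j * y j) (Finset.mem_univ i)

/-- Zero weights are left out: with `(c - 1) / 0 = 0` such a factor would be `0` and the bound would
fail in general. -/
theorem measureReal_sum_le_le_prod {Ω : Type*} [MeasurableSpace Ω] {P : Measure Ω}
    [IsProbabilityMeasure P] {n : ℕ} {g : ℝ → ℝ}
    {Y : Fin n → Ω → ℝ} {θ : Fin n → ℝ} {c : ℝ} (hconv : ConvexOn ℝ univ g)
    (hY : ∀ i, AEMeasurable (Y i) P) (hindep : iIndepFun Y P)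
    (hθ : θ ∈ stdSimplex ℝ (Fin n)) (hc : 1 ≤ c) (hge : ∀ i, ∀ᵐ ω ∂P, g 1 ≤ Y i ω)
    (htail : ∀ i, ∀ d, c ≤ d → 1 / d ≤ P.real {ω | g d < Y i ω}) :
    1 - P.real {ω | g c < ∑ i, θ i * Y i ω} ≤
      ∏ i with 0 < θ i, (1 - 1 / (1 + (c - 1) / θ i)) := by
  have hsum : AEMeasurable (fun ω => ∑ i, θ i * Y i ω) P :=
    Finset.aemeasurable_fun_sum _ fun i _ => (hY i).const_mul _
  have hs : NullMeasurableSet {ω | g c < ∑ i, θ i * Y i ω} P :=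
    hsum.nullMeasurableSet_preimage measurableSet_Ioi
  rw [← probReal_compl_eq_one_sub₀ hs]
  calc P.real {ω | g c < ∑ i, θ i * Y i ω}ᶜ
      ≤ P.real (⋂ i ∈ Finset.univ.filter fun i => 0 < θ i,
          Y i ⁻¹' Iic (g (1 + (c - 1) / θ i))) := by
        refine ENNReal.toReal_mono (measure_ne_top _ _) (measure_mono_ae ?_)
        filter_upwards [ae_all_iff.2 hge] with ω hω hle
        refine mem_iInter₂.2 fun i hi => ?_
        by_contra h
        exact hle (hconv.lt_sum_of_lt hθ hω (Finset.mem_filter.1 hi).2 (not_le.1 h))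
    _ = ∏ i with 0 < θ i, P.real (Y i ⁻¹' Iic (g (1 + (c - 1) / θ i))) := by
        simp only [measureReal_def]
        rw [hindep.measure_inter_preimage_eq_mul _ fun i _ => measurableSet_Iic,
          ENNReal.toReal_prod]
    _ ≤ _ := by
        refine Finset.prod_le_prod (fun i _ => measureReal_nonneg) fun i hi => ?_
        have hi : 0 < θ i := (Finset.mem_filter.1 hi).2
        have hθi : θ i ≤ 1 := hθ.2 ▸ Finset.single_le_sum (fun j _ => hθ.1 j) (Finset.mem_univ i)
        -- Since `θ i ≤ 1`, the threshold lies in the range covered by `htail`.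
        have hd : c ≤ 1 + (c - 1) / θ i := by
          have := le_div_self (sub_nonneg.2 hc) hi hθi
          linarith
        have hm : NullMeasurableSet {ω | g (1 + (c - 1) / θ i) < Y i ω} P :=
          (hY i).nullMeasurableSet_preimage measurableSet_Ioi
        have he : Y i ⁻¹' Iic (g (1 + (c - 1) / θ i)) =
            {ω | g (1 + (c - 1) / θ i) < Y i ω}ᶜ := by
          ext ω
          simp
        rw [he, probReal_compl_eq_one_sub₀ hm]
        exact sub_le_sub_left (htail i _ hd) _

theorem prod_one_sub_one_div_le {n : ℕ} {θ : Fin n → ℝ} {c : ℝ} (hθ : θ ∈ stdSimplex ℝ (Fin n))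
    (hc : 1 ≤ c) :
    ∏ i with 0 < θ i, (1 - 1 / (1 + (c - 1) / θ i)) ≤ 1 - 1 / c ∧
      (1 < c → (∃ i j, i ≠ j ∧ 0 < θ i ∧ 0 < θ j) →
        ∏ i with 0 < θ i, (1 - 1 / (1 + (c - 1) / θ i)) < 1 - 1 / c) := by
  have hsupp : ∑ i with 0 < θ i, θ i = 1 := by
    rw [Finset.sum_filter_of_ne fun i _ h => lt_of_le_of_ne (hθ.1 i) h.symm, hθ.2]
  -- At `c = 1` both sides vanish; otherwise one may divide by `c - 1`.
  rcases eq_or_lt_of_le hc with rfl | hc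
  · refine ⟨?_, fun h => absurd h (lt_irrefl _)⟩
    obtain ⟨i, hi⟩ : (Finset.univ.filter fun i => 0 < θ i).Nonempty := by
      refine Finset.nonempty_of_sum_ne_zero (f := θ) ?_
      rw [hsupp]
      exact one_ne_zero
    rw [Finset.prod_eq_zero hi (by simp)]
    simp
  · have hs : 0 < c - 1 := sub_pos.2 hc
    have ha : ∀ i, 0 ≤ θ i / (c - 1) := fun i => div_nonneg (hθ.1 i) hs.le
    have hprod : ∏ i with 0 < θ i, (1 - 1 / (1 + (c - 1) / θ i)) =
        (∏ i with 0 < θ i, (1 + θ i / (c - 1)))⁻¹ := by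
      rw [← Finset.prod_inv_distrib]
      refine Finset.prod_congr rfl fun i hi => ?_
      have hi : 0 < θ i := (Finset.mem_filter.1 hi).2
      field_simp
      ring
    have hsum : 1 - 1 / c = (1 + ∑ i with 0 < θ i, θ i / (c - 1))⁻¹ := by
      rw [← Finset.sum_div, hsupp]
      field_simp
      ring
    have hpos : 0 < 1 + ∑ i with 0 < θ i, θ i / (c - 1) :=
      add_pos_of_pos_of_nonneg one_pos (Finset.sum_nonneg fun i _ => ha i)
    rw [hprod, hsum]
    refine ⟨inv_anti₀ hpos (Finset.one_add_sum_le_prod_one_add_of_nonneg _ ha), ?_⟩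
    rintro - ⟨i, j, hij, hi, hj⟩
    exact inv_strictAnti₀ hpos (Finset.one_add_sum_lt_prod_one_add_of_nonneg _ ha hij
      (by simpa using hi) (by simpa using hj) (div_pos hi hs) (div_pos hj hs))

theorem mainTheorem7 {Ω : Type*} [MeasurableSpace Ω] (P : Measure Ω) [IsProbabilityMeasure P]
    (n : ℕ) (X : Ω → ℝ) (Y : Fin n → Ω → ℝ) (Y₀ : Ω → ℝ) (x : ℝ)
    (hX : IsSuperPareto X P)
    (hx : essInf X P ≤ x)
    (hindep : iIndepFun Y P)
    (hident : ∀ i, IdentDistrib Y₀ (Y i) P P)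
    (htail : DistributedAsBeyond Y₀ X x P)
    (hdom : StochasticLE X Y₀ P)
    (θ : Fin n → ℝ) (hθ : θ ∈ stdSimplex ℝ (Fin n))
    (t : ℝ) (ht : x ≤ t) :
    P {ω | t < Y₀ ω} ≤ P {ω | t < ∑ i, θ i * Y i ω} ∧
      (essInf X P < t → (∃ i j, i ≠ j ∧ 0 < θ i ∧ 0 < θ j) →
        P {ω | t < Y₀ ω} < P {ω | t < ∑ i, θ i * Y i ω}) := by
  obtain ⟨f, hf, hXlaw⟩ := hX
  obtain ⟨g, hmono, hconv, hfg, htop⟩ := hf.exists_extension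
  have hY : ∀ i, AEMeasurable (Y i) P := fun i => (hident i).aemeasurable_snd
  have hYtail : ∀ i u, P {ω | u < Y i ω} = P {ω | u < Y₀ ω} := fun i u =>
    ((hident i).measure_mem_eq measurableSet_Ioi).symm
  have hXone := measure_lt_eq_one_of_hasLaw_map_pareto hf hXlaw
  have hess : g 1 ≤ essInf X P := by
    rw [hfg 1 le_rfl]
    exact le_essInf_of_ae_le _ (ae_le_of_measure_lt_eq_one hXlaw.aemeasurable hXone)
      (isCoboundedUnder_ge_ae_real X)
  have hge : ∀ i, ∀ᵐ ω ∂P, g 1 ≤ Y i ω := fun i =>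
    ae_le_of_measure_lt_eq_one (hY i) fun u hu =>
      le_antisymm prob_le_one <| by
        rw [hYtail, ← hXone u (hfg 1 le_rfl ▸ hu)]
        exact hdom u
  obtain ⟨c, hc, rfl, hstrict⟩ :=
    hconv.exists_eq_and_strictMonoOn_Ici hmono htop (hess.trans (hx.trans ht))
  have hXtail : ∀ d, c ≤ d → P.real {ω | g d < X ω} = 1 / d := fun d hd =>
    measureReal_lt_apply_of_hasLaw_map_pareto hf hXlaw hmono hfg (hc.trans hd)
      (hstrict.mono (Ici_subset_Ici.2 hd))
  have htail' : ∀ i, ∀ d, c ≤ d → 1 / d ≤ P.real {ω | g d < Y i ω} := fun i d hd => by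
    rw [← hXtail d hd, measureReal_def, measureReal_def, hYtail]
    exact ENNReal.toReal_mono (measure_ne_top _ _) (hdom _)
  -- Equality of tails is used only at the level `t = g c`; above it, dominance is enough.
  have hY₀ : P.real {ω | g c < Y₀ ω} = 1 / c := by
    rw [← hXtail c le_rfl, measureReal_def, measureReal_def, htail _ ht]
  have hle := measureReal_sum_le_le_prod hconv hY hindep hθ hc hge htail'
  obtain ⟨hprod, hprod'⟩ := prod_one_sub_one_div_le hθ hc
  constructor
  · rw [← ENNReal.toReal_le_toReal (measure_ne_top _ _) (measure_ne_top _ _)]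
    change P.real _ ≤ P.real _
    linarith
  · intro hlt htwo
    -- From `g 1 ≤ essInf X P < g c` it follows that `1 < c`.
    have := hprod' (hmono.reflect_lt (hess.trans_lt hlt)) htwo
    rw [← ENNReal.toReal_lt_toReal (measure_ne_top _ _) (measure_ne_top _ _)]
    change P.real _ < P.real _
    linarith
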